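/- Let $\kappa$ be an uncountable regular cardinal; identify each cardinal with its initial ordinal, i.e. with the set of all smaller ordinals. A set $S$ of subsets of a set $A$ is called stationary if for every function $F:[A]^{<\omega}\to A$ there is $X\in S$ closed under $F$ (that is, $F(a)\in X$ for every finite $a\subseteq X$). A set $S$ of subsets of $\kappa^{+++}$ witnesses $(\kappa^{+++},\kappa^{++})\twoheadrightarrow_\kappa(\kappa^+,\kappa)$ if $S$ is stationary and every $X\in S$ satisfies $|X|=\kappa^+$, $|X\cap\kappa^{++}|=\kappa$ and $\kappa\subseteq X$; the property $(\kappa^{+++},\kappa^{++})\twoheadrightarrow_\kappa(\kappa^+,\kappa)$ holds if such an $S$ exists. Assume $(\kappa^{+++},\kappa^{++})\twoheadrightarrow_\kappa(\kappa^+,\kappa)$ and $2^{\kappa^+}\le\kappa^{++}$. Then for every (infinite) regular cardinal $\alpha<\kappa^+$ there is a set $S_\alpha$ of subsets of $\kappa^{+++}$ which witnesses $(\kappa^{+++},\kappa^{++})\twoheadrightarrow_\kappa(\kappa^+,\kappa)$ and is such that $\operatorname{cof}(X\cap\kappa^+)=\alpha$ for all $X\in S_\alpha$, where $\operatorname{cof}(X\cap\kappa^+)$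 is the cofinality of $X\cap\kappa^+$ ordered as a set of ordinals. -/

import Mathlib

open Cardinal

universe u

namespace ChangConjecture

/-- `X` is closed under `F : [A]^{<ω} → A`: every finite subset of `X` is sent into `X`. -/
def IsClosedUnder {A : Type*} (F : Finset A → A) (X : Set A) : Prop :=
  ∀ a : Finset A, (a : Set A) ⊆ X → F a ∈ X

/-- A set `S` of subsets of `A` is stationary if every `F : [A]^{<ω} → A` has a member of `S`
closed under it. -/
def IsStationaryFamily {A : Type*} (S : Set (Set A)) : Prop :=
  ∀ F : Finset A → A, ∃ X ∈ S, IsClosedUnder F X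

/-- The cardinal `l` as a von Neumann ordinal: the set of all ordinals below the initial
ordinal of `l`. -/
abbrev Below (l : Cardinal.{u}) : Type (u + 1) := Set.Iio l.ord

/-- `X ∩ m`, for `X ⊆ l` and a cardinal `m ≤ l`. -/
def cut {l : Cardinal.{u}} (X : Set (Below l)) (m : Cardinal.{u}) : Set (Below l) :=
  {x | x ∈ X ∧ (x : Ordinal.{u}) < m.ord}

/-- `X ⊆ l` is a Chang structure for `(l, k) ↠_m (l', k')`:
`Card X = l'`, `Card (X ∩ k) = k'` and `m ⊆ X`. -/
structure IsChangStructure (l k l' k' m : Cardinal.{u}) (X : Set (Below l)) : Prop where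
  card_eq : #X = Cardinal.lift.{u + 1} l'
  card_cut_eq : #(cut X k) = Cardinal.lift.{u + 1} k'
  subset : ∀ x : Below l, (x : Ordinal.{u}) < m.ord → x ∈ X

/-- `S` witnesses `(l, k) ↠_m (l', k')`: it is a stationary set of Chang structures. -/
def Witnesses (l k l' k' m : Cardinal.{u}) (S : Set (Set (Below l))) : Prop :=
  IsStationaryFamily S ∧ ∀ X ∈ S, IsChangStructure l k l' k' m X

/-- The Chang property `(l, k) ↠_m (l', k')`. -/
def ChangProperty (l k l' k' m : Cardinal.{u}) : Prop :=
  ∃ S : Set (Set (Below l)), Witnesses l k l' k' m S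

end ChangConjecture

namespace ChangConjecture

open Set Order

/-! ### Hulls under a function on finite sets. -/

section Hull

variable {A : Type*} {F : Finset A → A} {B C : Set A}

/-! Given `F`, a Chang structure `X` is enlarged to `Y = hull F (X ∪ γ)`, with `γ < κ⁺` of
cofinality `α` chosen so that `Y ∩ κ⁺ = γ`. The danger is that `Y ∩ κ⁺⁺` becomes too large;
`exists_forall_mk_hull_union_inter_le` excludes this. For finite `a`, the map sending a finite `s ⊆
κ⁺` to `hull F (a ∪ s) ∩ κ⁺⁺` is one of at most `(κ⁺⁺)^κ⁺ = κ⁺⁺` maps, so an ordinal below `κ⁺⁺`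
codes it. If `X` contains the codes of its finite subsets, only `|X ∩ κ⁺⁺| = κ` maps matter, each
used at `κ` many `s` with countable values. By regularity of `κ⁺`, a climbing sequence of length `α`
then yields `γ` (`exists_cof_eq_closed`). -/

/-- Membership in the least set which contains `B` and is closed under `F`. -/
inductive InHull (F : Finset A → A) (B : Set A) : A → Prop
  | base {x : A} (hx : x ∈ B) : InHull F B x
  | app (a : Finset A) (ha : ∀ x ∈ a, InHull F B x) : InHull F B (F a)

/-- The least set which contains `B` and is closed under `F`. -/
def hull (F : Finset A → A) (B : Set A) : Set A := {x | InHull F B x}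

theorem subset_hull : B ⊆ hull F B := fun _ hx => InHull.base hx

theorem isClosedUnder_hull : IsClosedUnder F (hull F B) :=
  fun a ha => InHull.app a fun _ hx => ha hx

theorem hull_subset (hB : B ⊆ C) (hC : IsClosedUnder F C) : hull F B ⊆ C := by
  intro x hx
  induction hx with
  | base hx => exact hB hx
  | app a _ ih => exact hC a ih

theorem hull_mono (h : B ⊆ C) : hull F B ⊆ hull F C :=
  hull_subset (h.trans subset_hull) isClosedUnder_hull

theorem exists_finset_mem_hull {x : A} (hx : x ∈ hull F B) :
    ∃ t : Finset A, (t : Set A) ⊆ B ∧ x ∈ hull F (t : Set A) := by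
  classical
  induction hx with
  | @base x hx => exact ⟨{x}, by simpa using hx, subset_hull (by simp)⟩
  | app a _ ih =>
    choose t ht hxt using ih
    refine ⟨a.attach.biUnion fun x => t x.1 x.2, ?_, isClosedUnder_hull a fun x hx => ?_⟩
    · simpa using fun x hx => ht x hx
    · refine hull_mono ?_ (hxt x hx)
      intro y hy
      simp only [Finset.coe_biUnion, mem_iUnion]
      exact ⟨⟨x, hx⟩, by simp, hy⟩

/-- The finite stages of the construction of the hull from below. -/
def hullStage (F : Finset A → A) (B : Set A) : ℕ → Set A
  | 0 => B
  | n + 1 => hullStage F B n ∪ F '' {a | (a : Set A) ⊆ hullStage F B n}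

theorem hull_subset_iUnion_hullStage : hull F B ⊆ ⋃ n, hullStage F B n := by
  have hmono : Monotone (hullStage F B) := monotone_nat_of_le_succ fun n => subset_union_left
  refine hull_subset (subset_iUnion (hullStage F B) 0) fun a ha => ?_
  obtain ⟨n, hn⟩ := hmono.directed_le.exists_mem_subset_of_finset_subset_biUnion ha
  exact mem_iUnion.2 ⟨n + 1, Or.inr ⟨a, hn, rfl⟩⟩

theorem countable_hull (hB : B.Finite) : (hull F B).Countable := by
  refine (countable_iUnion fun n => Finite.countable ?_).mono hull_subset_iUnion_hullStage
  induction n with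
  | zero => exact hB
  | succ n ih =>
    refine ih.union (Finite.image _ ?_)
    exact ih.finite_subsets.preimage Finset.coe_injective.injOn

end Hull

/-! ### Sizes of hulls and of their traces. -/

section Cardinality

variable {A : Type u} {F : Finset A → A}

theorem mk_finset_le_max (B : Type u) : #(Finset B) ≤ max #B ℵ₀ := by
  cases finite_or_infinite B
  · exact (lt_aleph0_of_finite _).le.trans (le_max_right _ _)
  · rw [mk_finset_of_infinite]; exact le_max_left _ _

theorem mk_hull_le (B : Set A) : #(hull F B) ≤ max #B ℵ₀ := by
  classical
  have hsub : hull F B ⊆ ⋃ t : Finset B, hull F ((↑) '' (t : Set B)) := by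
    intro x hx
    obtain ⟨t, ht, hxt⟩ := exists_finset_mem_hull hx
    refine mem_iUnion.2 ⟨t.subtype (· ∈ B), hull_mono (fun y hy => ?_) hxt⟩
    exact ⟨⟨y, ht hy⟩, by simpa using hy, rfl⟩
  calc #(hull F B) ≤ #(⋃ t : Finset B, hull F ((↑) '' (t : Set B))) := mk_le_mk_of_subset hsub
    _ ≤ #(Finset B) * ⨆ t : Finset B, #(hull F ((↑) '' (t : Set B))) := mk_iUnion_le _
    _ ≤ max #B ℵ₀ * ℵ₀ := by
      gcongr
      · exact mk_finset_le_max B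
      · exact ciSup_le' fun t => (countable_hull (t.finite_toSet.image _)).le_aleph0
    _ ≤ max #B ℵ₀ := mul_le_of_le (le_max_right _ _) le_rfl (le_max_right _ _)

/-- If `K₂` has as many elements as there are functions from `K₁` to `K₂`, then the traces on `K₂`
of the hulls of `X ∪ s` for `s ⊆ K₁` are small for all `X` closed under a suitable function. -/
theorem exists_forall_mk_hull_union_inter_le (F : Finset A → A) (K₁ K₂ : Set A)
    (h₁ : ℵ₀ ≤ #K₁) (h : #K₂ ^ #K₁ ≤ #K₂) (h₂ : ℵ₀ ≤ #K₂) :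
    ∃ G : Finset A → A, ∀ X : Set A, IsClosedUnder G X → ∀ s ⊆ K₁,
      #(hull F (X ∪ s) ∩ K₂ : Set A) ≤ max (max #(X ∩ K₂ : Set A) #s) ℵ₀ := by
  classical
  let T := Finset K₁ → {t : Set K₂ // #t ≤ ℵ₀}
  have hT : #T ≤ #K₂ := by
    have : Infinite K₁ := infinite_iff.2 h₁
    calc #T = #{t : Set K₂ // #t ≤ ℵ₀} ^ #K₁ := by simp [T]
      _ ≤ (max #K₂ ℵ₀ ^ ℵ₀) ^ #K₁ := power_le_power_right (mk_bounded_set_le _ _)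
      _ = #K₂ ^ #K₁ := by rw [max_eq_left h₂, ← power_mul, aleph0_mul_eq h₁]
      _ ≤ #K₂ := h
  obtain ⟨E⟩ := hT
  let tr (a : Finset A) : T := fun s =>
    ⟨(↑) ⁻¹' hull F ((a : Set A) ∪ (↑) '' (s : Set K₁)),
      ((countable_hull (a.finite_toSet.union (s.finite_toSet.image _))).preimage
        Subtype.val_injective).le_aleph0⟩
  -- `G` sends `a` to the code of its trace map; `D` below consists of the maps whose code lies in
  -- `X`.
  refine ⟨fun a => E (tr a), fun X hX s hs => ?_⟩
  let c := max (max #(X ∩ K₂ : Set A) #s) ℵ₀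
  let D : Set T := E ⁻¹' ((↑) ⁻¹' X)
  have hD : #D ≤ #(X ∩ K₂ : Set A) := by
    refine mk_le_of_injective (f := fun d : D => ⟨E d.1, d.2, (E d.1).2⟩) fun d e hde => ?_
    have hval : ((E d.1 : K₂) : A) = E e.1 := congrArg (fun z : (X ∩ K₂ : Set A) => (z : A)) hde
    exact Subtype.ext (E.injective (Subtype.ext hval))
  let toK (t : Finset s) : Finset K₁ := t.map ⟨inclusion hs, inclusion_injective hs⟩
  have hsub : (hull F (X ∪ s) ∩ K₂ : Set A) ⊆
      ⋃ p : D × Finset s, (↑) '' (p.1.1 (toK p.2)).1 := by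
    rintro x ⟨hx, hxK⟩
    obtain ⟨t, ht, hxt⟩ := exists_finset_mem_hull hx
    -- The generators `t` split into a part in `X`, whose code closure puts into `X`, and a part in
    -- `s`, which becomes the argument of the coded map.
    have hE : ((E (tr (t.filter (· ∈ X))) : K₂) : A) ∈ X := hX _ fun y hy => by
      simpa using (Finset.mem_filter.1 (Finset.mem_coe.1 hy)).2
    refine mem_iUnion.2 ⟨⟨⟨_, hE⟩, t.subtype (· ∈ s)⟩, ⟨x, hxK⟩, ?_, rfl⟩
    refine hull_mono (fun y hy => ?_) hxt
    rcases ht hy with hyX | hys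
    · exact Or.inl (by simpa using ⟨hy, hyX⟩)
    · refine Or.inr ⟨⟨y, hs hys⟩, ?_, rfl⟩
      simpa [toK, inclusion] using ⟨hy, hys⟩
  calc #(hull F (X ∪ s) ∩ K₂ : Set A)
      ≤ #(⋃ p : D × Finset s, ((↑) '' (p.1.1 (toK p.2)).1 : Set A)) := mk_le_mk_of_subset hsub
    _ ≤ #(D × Finset s) * ⨆ p : D × Finset s, #((↑) '' (p.1.1 (toK p.2)).1 : Set A) :=
      mk_iUnion_le _
    _ ≤ (c * c) * ℵ₀ := by
      gcongr
      · rw [mk_prod, lift_id, lift_id]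
        gcongr
        · exact hD.trans ((le_max_left _ _).trans (le_max_left _ _))
        · exact (mk_finset_le_max s).trans (max_le_max (le_max_right _ _) le_rfl)
      · exact ciSup_le' fun p => mk_image_le.trans (p.1.1 (toK p.2)).2
    _ ≤ c := by
      rw [mul_eq_self (le_max_right _ _)]
      exact mul_le_of_le (le_max_right _ _) le_rfl (le_max_right _ _)

end Cardinality

/-! ### Closure points of prescribed cofinality. -/

section Cofinality

/-- A continuous sequence of ordinals climbing faster than `g`. -/
noncomputable def climb (g : Ordinal.{u} → Ordinal.{u}) (i : Ordinal.{u}) : Ordinal.{u} :=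
  ⨆ j : Iio i, max j.1 (max (climb g j.1) (g (climb g j.1))) + 1
termination_by i
decreasing_by all_goals exact j.2

theorem lt_climb (g : Ordinal.{u} → Ordinal.{u}) {i j : Ordinal.{u}} (h : j < i) :
    climb g j < climb g i ∧ g (climb g j) < climb g i := by
  have : max j (max (climb g j) (g (climb g j))) < climb g i := by
    rw [climb.eq_def g i, ← Order.add_one_le_iff]
    exact Ordinal.le_iSup
      (fun j : Iio i => max j.1 (max (climb g j.1) (g (climb g j.1))) + 1) ⟨j, h⟩
  simp only [max_lt_iff] at this
  exact this.2

theorem climb_lt {g : Ordinal.{u} → Ordinal.{u}} {c : Cardinal.{u}} (hc : c.IsRegular)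
    (hg : ∀ x < c.ord, g x < c.ord) (i : Ordinal.{u}) (hi : i < c.ord) : climb g i < c.ord := by
  induction i using WellFoundedLT.induction with
  | ind i ih =>
    rw [climb]
    refine Ordinal.lift_iSup_add_one_lt_of_lt_cof ?_ fun j => ?_
    · rw [← Ordinal.lift_cof, hc.cof_ord, mk_Iio_ordinal, lift_lift, lift_lt]
      exact lt_ord.1 hi
    · have hj := ih j.1 j.2 (j.2.trans hi)
      exact max_lt (j.2.trans hi) (max_lt hj (hg _ hj))

/-- Take `γ` as the supremum of the first `a.ord` values of `climb g`: they increase strictly, and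
`g` of each lies below the next. -/
theorem exists_cof_eq_closed {c a : Cardinal.{u}} (hc : c.IsRegular) (ha : a.IsRegular)
    (hac : a < c) {g : Ordinal.{u} → Ordinal.{u}} (hg : ∀ x < c.ord, g x < c.ord) :
    ∃ γ < c.ord, γ.cof = a ∧ γ ≠ 0 ∧ ∀ x < γ, ∃ b, x < b ∧ b < γ ∧ g b < γ := by
  have hlim : IsSuccLimit a.ord := isSuccLimit_ord ha.aleph0_le
  have hmono : StrictMono fun j : Iio a.ord => climb g j.1 :=
    fun i j hij => (lt_climb g hij).1
  have hle (j : Iio a.ord) : climb g j.1 ≤ ⨆ j : Iio a.ord, climb g j.1 :=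
    Ordinal.le_iSup (fun j : Iio a.ord => climb g j.1) j
  have hcof : (⨆ j : Iio a.ord, climb g j.1).cof = a := by
    rw [Ordinal.cof_iSup_Iio hmono hlim.isSuccPrelimit, ha.cof_ord]
  refine ⟨⨆ j : Iio a.ord, climb g j.1, ?_, hcof, ?_, fun x hx => ?_⟩
  · refine Ordinal.lift_iSup_lt_of_lt_cof ?_ fun j =>
      climb_lt hc hg _ (j.2.trans (ord_lt_ord.2 hac))
    rwa [← Ordinal.lift_cof, hc.cof_ord, mk_Iio_ordinal, lift_lift, lift_lt, card_ord]
  · intro h0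
    exact ha.ne_zero (hcof.symm.trans (Ordinal.cof_eq_zero.2 h0))
  · obtain ⟨j, hj⟩ := (Ordinal.lt_iSup_iff).1 hx
    have h := lt_climb g (lt_succ j.1)
    have hs := hle ⟨succ j.1, hlim.succ_lt j.2⟩
    exact ⟨_, hj, h.1.trans_le hs, h.2.trans_le hs⟩

end Cofinality

/-! ### Initial segments of a cardinal and the extension of Chang structures. -/

section Below

variable {l : Cardinal.{u}}

/-- The ordinals below `γ`, as a subset of the cardinal `l`. -/
def segment (l : Cardinal.{u}) (γ : Ordinal.{u}) : Set (Below l) := {x | (x : Ordinal.{u}) < γ}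

/-- The ordinals below `γ ≤ l` and the corresponding initial segment of `l` are isomorphic. -/
def segmentIso {γ : Ordinal.{u}} (h : γ ≤ l.ord) : segment l γ ≃o Iio γ where
  toFun x := ⟨x.1.1, x.2⟩
  invFun x := ⟨⟨x.1, lt_of_lt_of_le x.2 h⟩, x.2⟩
  left_inv _ := rfl
  right_inv _ := rfl
  map_rel_iff' := Iff.rfl

theorem mk_segment {γ : Ordinal.{u}} (h : γ ≤ l.ord) :
    #(segment l γ) = Cardinal.lift.{u + 1} γ.card := by
  rw [mk_congr (segmentIso h).toEquiv, mk_Iio_ordinal]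

theorem cof_segment {γ : Ordinal.{u}} (h : γ ≤ l.ord) :
    Order.cof (segment l γ) = Cardinal.lift.{u + 1} γ.cof := by
  rw [(segmentIso h).cof_congr, Ordinal.cof_Iio, ← Ordinal.lift_cof]

end Below

/-- If `2 ^ κ⁺ ≤ κ⁺⁺`, then every `F` has a function `G` such that every Chang structure closed
under `G` extends to one closed under `F` which meets `κ⁺` in an ordinal of cofinality `α`. -/
theorem exists_forall_exists_isChangStructure_cof_eq {κ κ₁ κ₂ κ₃ α : Cardinal.{u}}
    (hκ : ℵ₀ ≤ κ) (hκ₁ : κ₁ = succ κ) (hκ₂ : κ₂ = succ κ₁) (h23 : κ₂ ≤ κ₃)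
    (hpow : (2 : Cardinal.{u}) ^ κ₁ ≤ κ₂) (hα : α.IsRegular) (hακ : α < κ₁)
    (F : Finset (Below κ₃) → Below κ₃) :
    ∃ G : Finset (Below κ₃) → Below κ₃, ∀ X : Set (Below κ₃),
      IsClosedUnder G X → IsChangStructure κ₃ κ₂ κ₁ κ κ X →
      ∃ Y, IsClosedUnder F Y ∧ IsChangStructure κ₃ κ₂ κ₁ κ κ Y ∧
        Order.cof (cut Y κ₁) = Cardinal.lift.{u + 1} α := by
  classical
  have h01 : κ ≤ κ₁ := hκ₁ ▸ le_succ κ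
  have h12 : κ₁ ≤ κ₂ := hκ₂ ▸ le_succ κ₁
  have o13 : κ₁.ord ≤ κ₃.ord := ord_le_ord.2 (h12.trans h23)
  have hreg : κ₁.IsRegular := hκ₁ ▸ isRegular_succ hκ
  have hK₁ : #(segment κ₃ κ₁.ord) = Cardinal.lift.{u + 1} κ₁ := by
    rw [mk_segment o13, card_ord]
  have hK₂ : #(segment κ₃ κ₂.ord) = Cardinal.lift.{u + 1} κ₂ := by
    rw [mk_segment (ord_le_ord.2 h23), card_ord]
  have hpow' : κ₂ ^ κ₁ ≤ κ₂ := by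
    calc κ₂ ^ κ₁ ≤ (2 ^ κ₁) ^ κ₁ := power_le_power_right (hκ₂ ▸ succ_le_of_lt (cantor κ₁))
      _ = 2 ^ κ₁ := by rw [← power_mul, mul_eq_self (hκ.trans h01)]
      _ ≤ κ₂ := hpow
  obtain ⟨G, hG⟩ := exists_forall_mk_hull_union_inter_le F (segment κ₃ κ₁.ord)
    (segment κ₃ κ₂.ord) (by rw [hK₁, aleph0_le_lift]; exact hκ.trans h01)
    (by rw [hK₁, hK₂, ← lift_power, lift_le]; exact hpow')
    (by rw [hK₂, aleph0_le_lift]; exact hκ.trans (h01.trans h12))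
  refine ⟨G, fun X hGX hX => ?_⟩
  have hκl : ℵ₀ ≤ Cardinal.lift.{u + 1} κ := aleph0_le_lift.2 hκ
  have hsmall (γ : Ordinal.{u}) (hγ : γ < κ₁.ord) :
      #(hull F (X ∪ segment κ₃ γ) ∩ segment κ₃ κ₂.ord : Set _) ≤ Cardinal.lift.{u + 1} κ := by
    refine (hG X hGX (segment κ₃ γ) fun x hx => lt_trans hx hγ).trans
      (max_le (max_le hX.card_cut_eq.le ?_) hκl)
    rw [mk_segment (hγ.le.trans o13), lift_le]
    exact lt_succ_iff.1 (hκ₁ ▸ lt_ord.1 hγ)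
  let V (γ : Ordinal.{u}) : Set Ordinal.{u} :=
    (↑) '' (hull F (X ∪ segment κ₃ γ) ∩ segment κ₃ κ₁.ord : Set (Below κ₃))
  -- The trace on `κ⁺` has size at most `κ`, so it is bounded in the regular cardinal `κ⁺`.
  have hV (γ : Ordinal.{u}) (hγ : γ < κ₁.ord) : sSup (V γ) < κ₁.ord := by
    refine Ordinal.sSup_lt_of_lt_cof ?_ ?_
    · rw [← Ordinal.lift_cof, hreg.cof_ord]
      refine lt_of_le_of_lt (mk_image_le.trans ((mk_le_mk_of_subset ?_).trans (hsmall γ hγ)))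
        (lift_lt.2 (hκ₁ ▸ lt_succ κ))
      exact inter_subset_inter_right _ fun x hx => lt_of_lt_of_le hx (ord_le_ord.2 h12)
    · rintro _ ⟨x, hx, rfl⟩
      exact hx.2
  obtain ⟨γ, hγ, hcof, hγ0, hclosed⟩ := exists_cof_eq_closed hreg hα hακ hV
  have hcut : cut (hull F (X ∪ segment κ₃ γ)) κ₁ = segment κ₃ γ := by
    apply Subset.antisymm
    · rintro x ⟨hx, hxκ⟩
      obtain ⟨t, ht, hxt⟩ := exists_finset_mem_hull hx
      -- Only finitely many generators lie below `γ`, so some `d < γ` already suffices in place of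
      -- `γ`. Generators at or above `γ` belong to `X` and count as `0`.
      have hbound : ∃ b < γ, ∀ y ∈ t, (y : Ordinal.{u}) < γ → (y : Ordinal.{u}) ≤ b := by
        refine ⟨t.sup fun y => if (y : Ordinal.{u}) < γ then (y : Ordinal.{u}) else 0,
          (Finset.sup_lt_iff (pos_iff_ne_zero.2 hγ0)).2 fun y _ => ?_, fun y hy hyγ => ?_⟩
        · split_ifs with h
          exacts [h, pos_iff_ne_zero.2 hγ0]
        · simpa [hyγ] using Finset.le_sup
            (f := fun y : Below κ₃ => if (y : Ordinal.{u}) < γ then (y : Ordinal.{u}) else 0) hy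
      obtain ⟨b, hbγ, hb⟩ := hbound
      obtain ⟨d, hbd, hdγ, hgd⟩ := hclosed b hbγ
      have hxd : x ∈ hull F (X ∪ segment κ₃ d) := by
        refine hull_mono (fun y hy => ?_) hxt
        exact (ht hy).imp id fun h => (hb y hy h).trans_lt hbd
      refine lt_of_le_of_lt (le_csSup (s := V d) ⟨κ₁.ord, ?_⟩ ⟨x, ⟨hxd, hxκ⟩, rfl⟩) hgd
      rintro _ ⟨z, hz, rfl⟩
      exact le_of_lt hz.2
    · exact fun x hx => ⟨subset_hull (Or.inr hx), lt_trans hx hγ⟩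
  have hXY : X ⊆ hull F (X ∪ segment κ₃ γ) := subset_union_left.trans subset_hull
  have hlow : segment κ₃ κ.ord ⊆ X := hX.subset
  refine ⟨hull F (X ∪ segment κ₃ γ), isClosedUnder_hull, ⟨?_, ?_, ?_⟩, ?_⟩
  · apply le_antisymm
    · refine (mk_hull_le _).trans (max_le ?_ (hκl.trans (lift_le.2 h01)))
      refine (mk_union_le _ _).trans (add_le_of_le (hκl.trans (lift_le.2 h01)) hX.card_eq.le ?_)
      rw [mk_segment (hγ.le.trans o13), lift_le]
      exact (lt_ord.1 hγ).le
    · exact hX.card_eq.ge.trans (mk_le_mk_of_subset hXY)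
  · apply le_antisymm (hsmall γ hγ)
    exact hX.card_cut_eq.ge.trans (mk_le_mk_of_subset (inter_subset_inter_left _ hXY))
  · exact hlow.trans hXY
  · rw [hcut, cof_segment (hγ.le.trans o13), hcof]

end ChangConjecture

theorem mainTheorem4 (κ : Cardinal.{u}) (hκ : ℵ₀ < κ) (hκreg : κ.IsRegular)
    (hChang : ChangConjecture.ChangProperty
      (Order.succ (Order.succ (Order.succ κ))) (Order.succ (Order.succ κ)) (Order.succ κ) κ κ)
    (hpow : (2 : Cardinal.{u}) ^ Order.succ κ ≤ Order.succ (Order.succ κ)) :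
    ∀ α : Cardinal.{u}, α.IsRegular → α < Order.succ κ →
      ∃ S : Set (Set (ChangConjecture.Below (Order.succ (Order.succ (Order.succ κ))))),
        ChangConjecture.Witnesses
          (Order.succ (Order.succ (Order.succ κ))) (Order.succ (Order.succ κ)) (Order.succ κ) κ κ
          S ∧
        ∀ X ∈ S, Order.cof (ChangConjecture.cut X (Order.succ κ)) = Cardinal.lift.{u + 1} α := by
  intro α hα hακ
  refine ⟨{Y | ChangConjecture.IsChangStructure _ _ _ _ _ Y ∧
    Order.cof (ChangConjecture.cut Y (Order.succ κ)) = Cardinal.lift.{u + 1} α},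
    ⟨fun F => ?_, fun Y hY => hY.1⟩, fun Y hY => hY.2⟩
  obtain ⟨S, hS, hSX⟩ := hChang
  obtain ⟨G, hG⟩ := ChangConjecture.exists_forall_exists_isChangStructure_cof_eq hκ.le rfl rfl
    (Order.le_succ _) hpow hα hακ F
  obtain ⟨X, hXS, hXG⟩ := hS G
  obtain ⟨Y, hYF, hY, hcof⟩ := hG X hXG (hSX X hXS)
  exact ⟨Y, ⟨hY, hcof⟩, hYF⟩
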